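/- Let $\mathbb K=\mathbb R$ or $\mathbb C$, let $\Omega\subseteq\mathbb R^m$ be open, and fix an exhaustive sequence $(\Omega_l)_{l\in\mathbb N}$ of open subsets of $\Omega$: each $\overline{\Omega}_l$ is compact, $\overline{\Omega}_l\subset\Omega_{l+1}$, and $\bigcup_l\Omega_l=\Omega$. For $q\in\mathbb N$ let $\mathcal A_q$ be the set of $\varphi\in\mathcal D(\mathbb R^m;\mathbb K)$ with $\int\varphi=1$ and $\int x^\alpha\varphi(x)\,dx=0$ for $1\le|\alpha|\le q$; put $\varphi_\varepsilon(x)=\varepsilon^{-m}\varphi(x/\varepsilon)$ and $i(\varphi)=\operatorname{diam}\operatorname{supp}\varphi$. Let $\Gamma$ be the set of increasing $\gamma:\mathbb N\to\mathbb R_+$ with $\gamma(q)\to\infty$. A function $\nu:\mathcal A_0\to\mathbb R$ is *moderate* if there is $N\in\mathbb N$ such that for all $\varphi\in\mathcal A_N$ there are $c>0$, $\eta\in\,]0,1]$ with $|\nu(\varphi_\varepsilon)|\le c\,\varepsilon^{-N}$ for $0<\varepsilon<\eta$; it is *null* if there are $N\in\mathbb N$, $\gamma\in\Gamma$ such that for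 all $q\ge N$ and $\varphi\in\mathcal A_q$ there are $c>0$, $\eta\in\,]0,1]$ with $|\nu(\varphi_\varepsilon)|\le c\,\varepsilon^{\gamma(q)-N}$ for $0<\varepsilon<\eta$. Let $\overline{\mathbb R}$ be the ring of moderate functions modulo null functions, $\mathrm{cl}(\nu)$ the class of $\nu$, and let $x\le y$ in $\overline{\mathbb R}$ mean that $y-x$ has a representative that is $\ge0$ everywhere on $\mathcal A_0$. Let $\mathcal E_M[\Omega]$ (resp. $\mathcal N[\Omega]$) be the set of $u:\mathcal A_0\times\Omega\to\mathbb K$ with $u(\varphi,\cdot)\in\mathcal C^\infty(\Omega)$ for every $\varphi\in\mathcal A_0$ such that $\varphi\mapsto\sup_{x\in K}|\partial^\sigma u(\varphi,x)|$ is moderate (resp. such that $u\in\mathcal E_M[\Omega]$ and this function is null) for every compact $K\subset\Omega$ and every $\sigma\in\mathbb N^m$. The full Colombeau algebra is $\mathcal G(\Omega)=\mathcal E_M[\Omega]/\mathcal N[\Omega]$. The support of $f\in\mathcal G(\Omega)$ is the set of points of $\Omega$ that have no open neighbourhood $V\subseteq\Omega$ with $f|_V=0$ in $\mathcal G(V)$.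 For $f\in\mathcal G(\Omega)$ with representative $u$ put $\|f\|_{l,\kappa}=\mathrm{cl}\big(\varphi\mapsto\sup_{x\in\Omega_l}|\partial^\kappa u(\varphi,x)|\big)\in\overline{\mathbb R}$, and let $\alpha_r=\mathrm{cl}(\varphi\mapsto i(\varphi)^r)$. Let $\mathcal T_\Omega$ be the translation invariant topology on $\mathcal G(\Omega)$ for which the sets $$W^{\sigma}_{l,r}=\{f\in\mathcal G(\Omega):\ \|f\|_{l,\kappa}\le\alpha_r\ \text{ for all }\kappa\le\sigma\},\qquad \sigma\in\mathbb N^m,\ l\in\mathbb N,\ r\in\mathbb N,\ r\ge1,$$ are a fundamental system of neighbourhoods of $0$. **Proposition.** The set $\mathcal G_c(\Omega)=\{f\in\mathcal G(\Omega):\operatorname{supp} f\text{ is a compact subset of }\Omega\}$ is an ideal of $\mathcal G(\Omega)$, and it is dense in $(\mathcal G(\Omega),\mathcal T_\Omega)$. -/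

import Mathlib

open Set Filter Topology MeasureTheory TopologicalSpace
open scoped ContDiff

noncomputable section

namespace Colombeau

/-- The space `ℝ^m` with its Euclidean norm. -/
abbrev Euc (m : ℕ) : Type := EuclideanSpace ℝ (Fin m)

/-! ### Test functions -/

/-- `A₀(m; 𝕜)`: the test functions `φ ∈ 𝓓(ℝ^m; 𝕜)` with `∫ φ = 1`. -/
def A0 (𝕜 : Type*) [RCLike 𝕜] (m : ℕ) : Type _ :=
  {φ : Euc m → 𝕜 // ContDiff ℝ ∞ φ ∧ HasCompactSupport φ ∧ ∫ x, φ x = 1}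

/-- The monomial `x ^ α`. -/
def monomial {m : ℕ} (α : Fin m → ℕ) (x : Euc m) : ℝ := ∏ i, x i ^ α i

/-- `A_q(m; 𝕜)`: the `φ ∈ A₀(m; 𝕜)` with `∫ x ^ α φ(x) dx = 0` for `1 ≤ |α| ≤ q`. -/
def A (𝕜 : Type*) [RCLike 𝕜] (m q : ℕ) : Set (A0 𝕜 m) :=
  {φ | ∀ α : Fin m → ℕ, 1 ≤ ∑ i, α i → ∑ i, α i ≤ q → ∫ x, monomial α x • φ.1 x = 0}

theorem A_anti (𝕜 : Type*) [RCLike 𝕜] (m : ℕ) {p q : ℕ} (h : p ≤ q) : A 𝕜 m q ⊆ A 𝕜 m p :=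
  fun _ hφ α h1 h2 => hφ α h1 (h2.trans h)

/-- `φ_ε(x) = ε ^ (-m) φ(x / ε)`. -/
def A0.scale {𝕜 : Type*} [RCLike 𝕜] {m : ℕ} (φ : A0 𝕜 m) (ε : ℝ) (hε : 0 < ε) : A0 𝕜 m :=
  ⟨fun x => (ε ^ m)⁻¹ • φ.1 (ε⁻¹ • x), by
    obtain ⟨h1, h2, h3⟩ := φ.2
    refine ⟨?_, ?_, ?_⟩
    · exact (contDiff_const (𝕜 := ℝ) (c := (ε ^ m)⁻¹)).smul (h1.comp
        ((contDiff_const (𝕜 := ℝ) (c := ε⁻¹)).smul (contDiff_id (𝕜 := ℝ) (E := Euc m))))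
    · exact HasCompactSupport.smul_left (f := fun _ : Euc m => (ε ^ m)⁻¹)
        (h2.comp_smul (inv_ne_zero hε.ne'))
    · rw [integral_smul, Measure.integral_comp_inv_smul_of_nonneg _ _ hε.le, h3,
        finrank_euclideanSpace, Fintype.card_fin, smul_smul,
        inv_mul_cancel₀ (pow_pos hε m).ne', one_smul]⟩

/-- `i(φ) = diam (supp φ)`. -/
def A0.diamSupp {𝕜 : Type*} [RCLike 𝕜] {m : ℕ} (φ : A0 𝕜 m) : ℝ := Metric.diam (tsupport φ.1)

theorem A0.diamSupp_nonneg {𝕜 : Type*} [RCLike 𝕜] {m : ℕ} (φ : A0 𝕜 m) : 0 ≤ φ.diamSupp :=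
  Metric.diam_nonneg

section Scaling

open scoped Pointwise

theorem A0.diamSupp_scale_le {𝕜 : Type*} [RCLike 𝕜] {m : ℕ} (φ : A0 𝕜 m) (ε : ℝ) (hε : 0 < ε) :
    (φ.scale ε hε).diamSupp ≤ ε * φ.diamSupp := by
  have hc : IsCompact (ε • tsupport φ.1) := (IsCompact.smul ε φ.2.2.1)
  have hsub : tsupport (φ.scale ε hε).1 ⊆ ε • tsupport φ.1 := by
    refine closure_minimal ?_ hc.isClosed
    intro x hx
    have hx' : φ.1 (ε⁻¹ • x) ≠ 0 := fun h => hx (by simp [A0.scale, h])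
    exact ⟨ε⁻¹ • x, subset_tsupport _ hx', by simp [smul_smul, hε.ne']⟩
  calc (φ.scale ε hε).diamSupp ≤ Metric.diam (ε • tsupport φ.1) :=
        Metric.diam_mono hsub hc.isBounded
    _ = ε * φ.diamSupp := by
        rw [diam_smul₀, Real.norm_of_nonneg hε.le]; rfl

end Scaling

/-! ### Growth of nets indexed by test functions -/

section Nets

variable {𝕜 : Type*} [RCLike 𝕜] {m : ℕ}

/-- There are `c > 0` and `η ∈ ]0, 1]` with `|ν(φ_ε)| ≤ c ε ^ a` for all `ε ∈ ]0, η[`. -/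
def BigO (ν : A0 𝕜 m → ℝ) (φ : A0 𝕜 m) (a : ℝ) : Prop :=
  ∃ c : ℝ, 0 < c ∧ ∃ η : ℝ, 0 < η ∧ η ≤ 1 ∧
    ∀ (ε : ℝ) (hε : 0 < ε), ε < η → |ν (φ.scale ε hε)| ≤ c * ε ^ a

/-- The set `Γ` of increasing functions `γ : ℕ → ℝ₊` with `γ(q) → ∞`. -/
def Gam : Set (ℕ → ℝ) := {γ | Monotone γ ∧ (∀ q, 0 ≤ γ q) ∧ Tendsto γ atTop atTop}

/-- Moderate nets. -/
def Moderate (ν : A0 𝕜 m → ℝ) : Prop :=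
  ∃ N : ℕ, ∀ φ ∈ A 𝕜 m N, BigO ν φ (-(N : ℝ))

/-- Null nets. -/
def Negligible (ν : A0 𝕜 m → ℝ) : Prop :=
  ∃ N : ℕ, ∃ γ ∈ Gam, ∀ q, N ≤ q → ∀ φ ∈ A 𝕜 m q, BigO ν φ (γ q - N)

theorem BigO.mono_exp {ν : A0 𝕜 m → ℝ} {φ : A0 𝕜 m} {a b : ℝ} (h : BigO ν φ a) (hab : b ≤ a) :
    BigO ν φ b := by
  obtain ⟨c, hc, η, hη, hη1, H⟩ := h
  refine ⟨c, hc, η, hη, hη1, fun ε hε hlt => (H ε hε hlt).trans ?_⟩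
  have := Real.rpow_le_rpow_of_exponent_ge hε (hlt.le.trans hη1) hab
  gcongr

theorem BigO.mono {ν μ : A0 𝕜 m → ℝ} {φ : A0 𝕜 m} {a : ℝ} (h : BigO μ φ a)
    (hle : ∀ ψ, |ν ψ| ≤ |μ ψ|) : BigO ν φ a := by
  obtain ⟨c, hc, η, hη, hη1, H⟩ := h
  exact ⟨c, hc, η, hη, hη1, fun ε hε hlt => (hle _).trans (H ε hε hlt)⟩

theorem BigO.add {ν μ : A0 𝕜 m → ℝ} {φ : A0 𝕜 m} {a : ℝ} (h : BigO ν φ a) (h' : BigO μ φ a) :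
    BigO (ν + μ) φ a := by
  obtain ⟨c, hc, η, hη, hη1, H⟩ := h
  obtain ⟨c', hc', η', hη', hη1', H'⟩ := h'
  refine ⟨c + c', by positivity, min η η', lt_min hη hη', (min_le_left _ _).trans hη1,
    fun ε hε hlt => ?_⟩
  have h1 := H ε hε (hlt.trans_le (min_le_left _ _))
  have h2 := H' ε hε (hlt.trans_le (min_le_right _ _))
  calc |(ν + μ) (φ.scale ε hε)| ≤ _ := abs_add_le _ _
    _ ≤ (c + c') * ε ^ a := by linarith

theorem BigO.mul {ν μ : A0 𝕜 m → ℝ} {φ : A0 𝕜 m} {a b : ℝ} (h : BigO ν φ a) (h' : BigO μ φ b) :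
    BigO (ν * μ) φ (a + b) := by
  obtain ⟨c, hc, η, hη, hη1, H⟩ := h
  obtain ⟨c', hc', η', hη', hη1', H'⟩ := h'
  refine ⟨c * c', by positivity, min η η', lt_min hη hη', (min_le_left _ _).trans hη1,
    fun ε hε hlt => ?_⟩
  have h1 := H ε hε (hlt.trans_le (min_le_left _ _))
  have h2 := H' ε hε (hlt.trans_le (min_le_right _ _))
  rw [Pi.mul_apply, abs_mul, Real.rpow_add hε]
  calc _ ≤ (c * ε ^ a) * (c' * ε ^ b) := mul_le_mul h1 h2 (abs_nonneg _) (by positivity)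
    _ = _ := by ring

theorem Moderate.mono {ν μ : A0 𝕜 m → ℝ} (h : Moderate μ) (hle : ∀ ψ, |ν ψ| ≤ |μ ψ|) :
    Moderate ν := by
  obtain ⟨N, H⟩ := h
  exact ⟨N, fun φ hφ => (H φ hφ).mono hle⟩

theorem Moderate.add {ν μ : A0 𝕜 m → ℝ} (h : Moderate ν) (h' : Moderate μ) :
    Moderate (ν + μ) := by
  obtain ⟨N, H⟩ := h
  obtain ⟨N', H'⟩ := h'
  refine ⟨max N N', fun φ hφ => ?_⟩
  have e1 : (N : ℝ) ≤ (max N N' : ℕ) := by exact_mod_cast le_max_left _ _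
  have e2 : (N' : ℝ) ≤ (max N N' : ℕ) := by exact_mod_cast le_max_right _ _
  exact ((H φ (A_anti 𝕜 m (le_max_left _ _) hφ)).mono_exp (neg_le_neg e1)).add
    ((H' φ (A_anti 𝕜 m (le_max_right _ _) hφ)).mono_exp (neg_le_neg e2))

theorem Moderate.mul {ν μ : A0 𝕜 m → ℝ} (h : Moderate ν) (h' : Moderate μ) :
    Moderate (ν * μ) := by
  obtain ⟨N, H⟩ := h
  obtain ⟨N', H'⟩ := h'
  refine ⟨N + N', fun φ hφ => ?_⟩
  have := (H φ (A_anti 𝕜 m (Nat.le_add_right _ _) hφ)).mul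
    (H' φ (A_anti 𝕜 m (Nat.le_add_left _ _) hφ))
  refine this.mono_exp (le_of_eq ?_)
  push_cast; ring

theorem moderate_const (c : ℝ) : Moderate (fun _ : A0 𝕜 m => c) := by
  refine ⟨0, fun φ _ => ⟨|c| + 1, by positivity, 1, one_pos, le_rfl, fun ε hε _ => ?_⟩⟩
  simp

theorem id_mem_Gam : (fun q : ℕ => (q : ℝ)) ∈ Gam :=
  ⟨fun _ _ h => Nat.cast_le.2 h, fun q => q.cast_nonneg, tendsto_natCast_atTop_atTop⟩

/-- A net that vanishes at `φ_ε` for small `ε` is null. -/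
theorem negligible_of_eventually_zero {ν : A0 𝕜 m → ℝ}
    (h : ∀ φ : A0 𝕜 m, ∃ η : ℝ, 0 < η ∧ ∀ (ε : ℝ) (hε : 0 < ε), ε < η → ν (φ.scale ε hε) = 0) :
    Negligible ν := by
  refine ⟨0, _, id_mem_Gam, fun q _ φ _ => ?_⟩
  obtain ⟨η, hη, H⟩ := h φ
  refine ⟨1, one_pos, min η 1, lt_min hη one_pos, min_le_right _ _, fun ε hε hlt => ?_⟩
  rw [H ε hε (hlt.trans_le (min_le_left _ _)), abs_zero]
  positivity

theorem negligible_zero : Negligible (0 : A0 𝕜 m → ℝ) :=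
  negligible_of_eventually_zero fun _ => ⟨1, one_pos, fun _ _ _ => rfl⟩

theorem Negligible.mono {ν μ : A0 𝕜 m → ℝ} (h : Negligible μ) (hle : ∀ ψ, |ν ψ| ≤ |μ ψ|) :
    Negligible ν := by
  obtain ⟨N, γ, hγ, H⟩ := h
  exact ⟨N, γ, hγ, fun q hq φ hφ => (H q hq φ hφ).mono hle⟩

theorem Negligible.add {ν μ : A0 𝕜 m → ℝ} (h : Negligible ν) (h' : Negligible μ) :
    Negligible (ν + μ) := by
  obtain ⟨N, γ, hγ, H⟩ := h
  obtain ⟨N', γ', hγ', H'⟩ := h'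
  refine ⟨max N N', fun q => min (γ q) (γ' q), ⟨?_, ?_, ?_⟩, fun q hq φ hφ => ?_⟩
  · exact hγ.1.min hγ'.1
  · exact fun q => le_min (hγ.2.1 q) (hγ'.2.1 q)
  · rw [tendsto_atTop]
    intro b
    filter_upwards [tendsto_atTop.1 hγ.2.2 b, tendsto_atTop.1 hγ'.2.2 b] with q h1 h2
    exact le_min h1 h2
  · have e1 : (N : ℝ) ≤ (max N N' : ℕ) := by exact_mod_cast le_max_left _ _
    have e2 : (N' : ℝ) ≤ (max N N' : ℕ) := by exact_mod_cast le_max_right _ _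
    have e3 : min (γ q) (γ' q) ≤ γ q := min_le_left _ _
    have e4 : min (γ q) (γ' q) ≤ γ' q := min_le_right _ _
    exact ((H q ((le_max_left _ _).trans hq) φ hφ).mono_exp (by linarith)).add
      ((H' q ((le_max_right _ _).trans hq) φ hφ).mono_exp (by linarith))

theorem Moderate.mul_negligible {ν μ : A0 𝕜 m → ℝ} (h : Moderate ν) (h' : Negligible μ) :
    Negligible (ν * μ) := by
  obtain ⟨N, H⟩ := h
  obtain ⟨N', γ, hγ, H'⟩ := h'
  refine ⟨N + N', γ, hγ, fun q hq φ hφ => ?_⟩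
  have := (H φ (A_anti 𝕜 m (le_trans (Nat.le_add_right _ _) hq) hφ)).mul
    (H' q (le_trans (Nat.le_add_left _ _) hq) φ hφ)
  refine this.mono_exp (le_of_eq ?_)
  push_cast; ring

theorem Moderate.list_sum {ι : Type*} (L : List ι) (F : ι → A0 𝕜 m → ℝ)
    (h : ∀ i ∈ L, Moderate (F i)) : Moderate (fun φ => (L.map fun i => F i φ).sum) := by
  induction L with
  | nil => simpa using moderate_const (𝕜 := 𝕜) (m := m) 0
  | cons a L ih =>
    simp only [List.map_cons, List.sum_cons]
    exact (h a (by simp)).add (ih fun i hi => h i (by simp [hi]))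

theorem Negligible.list_sum {ι : Type*} (L : List ι) (F : ι → A0 𝕜 m → ℝ)
    (h : ∀ i ∈ L, Negligible (F i)) : Negligible (fun φ => (L.map fun i => F i φ).sum) := by
  induction L with
  | nil => exact negligible_zero
  | cons a L ih =>
    simp only [List.map_cons, List.sum_cons]
    exact (h a (by simp)).add (ih fun i hi => h i (by simp [hi]))

end Nets

/-! ### Generalized real numbers -/

/-- The ring `𝓔_M(ℝ)` of moderate nets of real numbers. -/
def EMReal (𝕜 : Type*) [RCLike 𝕜] (m : ℕ) : Subring (A0 𝕜 m → ℝ) where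
  carrier := {ν | Moderate ν}
  mul_mem' h h' := Moderate.mul h h'
  one_mem' := moderate_const 1
  add_mem' h h' := Moderate.add h h'
  zero_mem' := moderate_const 0
  neg_mem' h := Moderate.mono h fun ψ => by simp

/-- The ideal `𝓝(ℝ)` of null nets. -/
def NReal (𝕜 : Type*) [RCLike 𝕜] (m : ℕ) : Ideal (EMReal 𝕜 m) where
  carrier := {ν | Negligible ν.1}
  add_mem' h h' := Negligible.add h h'
  zero_mem' := negligible_zero
  smul_mem' c _ h := Moderate.mul_negligible c.2 h

/-- The ring of (full) Colombeau generalized real numbers. -/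
abbrev GenReal (𝕜 : Type*) [RCLike 𝕜] (m : ℕ) : Type _ := EMReal 𝕜 m ⧸ NReal 𝕜 m

/-- The class `cl(ν)` of a moderate net. -/
def GenReal.cl {𝕜 : Type*} [RCLike 𝕜] {m : ℕ} (ν : A0 𝕜 m → ℝ) (h : Moderate ν) :
    GenReal 𝕜 m := Ideal.Quotient.mk (NReal 𝕜 m) ⟨ν, h⟩

/-- `x ≤ y` means that `y - x` has a representative that is `≥ 0` at every `φ ∈ A₀`. -/
instance GenReal.instLE (𝕜 : Type*) [RCLike 𝕜] (m : ℕ) : LE (GenReal 𝕜 m) where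
  le x y := ∃ ν : EMReal 𝕜 m, Ideal.Quotient.mk (NReal 𝕜 m) ν = y - x ∧ ∀ φ, 0 ≤ ν.1 φ

section GenRealOrder

variable {𝕜 : Type*} [RCLike 𝕜] {m : ℕ}

theorem GenReal.le_trans {x y z : GenReal 𝕜 m} (h : x ≤ y) (h' : y ≤ z) : x ≤ z := by
  obtain ⟨ν, h1, h2⟩ := h
  obtain ⟨μ, h3, h4⟩ := h'
  exact ⟨ν + μ, by rw [map_add, h1, h3]; ring, fun φ => add_nonneg (h2 φ) (h4 φ)⟩

theorem GenReal.add_le_add {x y z w : GenReal 𝕜 m} (h : x ≤ y) (h' : z ≤ w) :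
    x + z ≤ y + w := by
  obtain ⟨ν, h1, h2⟩ := h
  obtain ⟨μ, h3, h4⟩ := h'
  exact ⟨ν + μ, by rw [map_add, h1, h3]; ring, fun φ => add_nonneg (h2 φ) (h4 φ)⟩

theorem GenReal.cl_le_cl {ν μ : A0 𝕜 m → ℝ} (hν : Moderate ν) (hμ : Moderate μ)
    (h : ∀ φ : A0 𝕜 m, ∃ η : ℝ, 0 < η ∧
      ∀ (ε : ℝ) (hε : 0 < ε), ε < η → ν (φ.scale ε hε) ≤ μ (φ.scale ε hε)) :
    GenReal.cl ν hν ≤ GenReal.cl μ hμ := by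
  have hm : Moderate fun φ => |μ φ - ν φ| := by
    refine (hμ.add (hν.mono (ν := -ν) fun ψ => by simp)).mono fun ψ => ?_
    simp [sub_eq_add_neg]
  refine ⟨⟨_, hm⟩, ?_, fun φ => abs_nonneg _⟩
  rw [GenReal.cl, GenReal.cl, ← map_sub, Ideal.Quotient.eq]
  refine negligible_of_eventually_zero fun φ => ?_
  obtain ⟨η, hη, H⟩ := h φ
  refine ⟨η, hη, fun ε hε hlt => ?_⟩
  change |μ (φ.scale ε hε) - ν (φ.scale ε hε)| - (μ (φ.scale ε hε) - ν (φ.scale ε hε)) = 0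
  rw [abs_of_nonneg (sub_nonneg.2 (H ε hε hlt)), sub_self]

theorem moderate_diamSupp_pow (r : ℕ) : Moderate fun φ : A0 𝕜 m => φ.diamSupp ^ r := by
  refine ⟨0, fun φ _ => ⟨φ.diamSupp ^ r + 1, ?_, 1, one_pos, le_rfl, fun ε hε hlt => ?_⟩⟩
  · have := φ.diamSupp_nonneg; positivity
  · have h0 := φ.diamSupp_nonneg
    have h1 := (φ.scale ε hε).diamSupp_nonneg
    have h2 := φ.diamSupp_scale_le ε hε
    have h3 : (φ.scale ε hε).diamSupp ≤ φ.diamSupp := h2.trans (by nlinarith)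
    rw [abs_of_nonneg (pow_nonneg h1 r)]
    simp only [Nat.cast_zero, neg_zero, Real.rpow_zero, mul_one]
    have := pow_le_pow_left₀ h1 h3 r
    linarith

/-- The generalized number `α_r = cl(φ ↦ i(φ) ^ r)`. -/
def alpha (𝕜 : Type*) [RCLike 𝕜] (m r : ℕ) : GenReal 𝕜 m :=
  GenReal.cl (fun φ : A0 𝕜 m => φ.diamSupp ^ r) (moderate_diamSupp_pow r)

theorem diamSupp_scale_eventually_le (φ : A0 𝕜 m) (δ : ℝ) (hδ : 0 < δ) :
    ∃ η : ℝ, 0 < η ∧ ∀ (ε : ℝ) (hε : 0 < ε), ε < η → (φ.scale ε hε).diamSupp ≤ δ := by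
  have h0 := φ.diamSupp_nonneg
  refine ⟨δ / (φ.diamSupp + 1), by positivity, fun ε hε hlt => ?_⟩
  rw [lt_div_iff₀ (by positivity)] at hlt
  have := φ.diamSupp_scale_le ε hε
  nlinarith

theorem alpha_anti {r s : ℕ} (h : r ≤ s) : alpha 𝕜 m s ≤ alpha 𝕜 m r := by
  refine GenReal.cl_le_cl _ _ fun φ => ?_
  obtain ⟨η, hη, H⟩ := diamSupp_scale_eventually_le φ 1 one_pos
  exact ⟨η, hη, fun ε hε hlt =>
    pow_le_pow_of_le_one (φ.scale ε hε).diamSupp_nonneg (H ε hε hlt) h⟩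

theorem alpha_succ_add_le (r : ℕ) : alpha 𝕜 m (r + 1) + alpha 𝕜 m (r + 1) ≤ alpha 𝕜 m r := by
  refine GenReal.cl_le_cl ((moderate_diamSupp_pow (r + 1)).add (moderate_diamSupp_pow (r + 1)))
    (moderate_diamSupp_pow r) fun φ => ?_
  obtain ⟨η, hη, H⟩ := diamSupp_scale_eventually_le φ (1 / 2) (by norm_num)
  refine ⟨η, hη, fun ε hε hlt => ?_⟩
  have h1 := H ε hε hlt
  have h2 := pow_nonneg (φ.scale ε hε).diamSupp_nonneg r
  simp only [Pi.add_apply, pow_succ]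
  nlinarith

end GenRealOrder

/-! ### Partial derivatives -/

section Deriv

variable {𝕜 : Type*} [RCLike 𝕜] {m : ℕ}

/-- The partial derivative `∂f/∂x_i`. -/
def pd (i : Fin m) (f : Euc m → 𝕜) (x : Euc m) : 𝕜 := fderiv ℝ f x (EuclideanSpace.single i 1)

/-- The composition `∂_{i_1} ∂_{i_2} ⋯ ∂_{i_n} f` for a list `[i_1, …, i_n]` of indices. -/
def pdWord (w : List (Fin m)) (f : Euc m → 𝕜) : Euc m → 𝕜 := w.foldr pd f

/-- The list of indices in which each `i` occurs `σ i` times, in increasing order. -/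
def word (σ : Fin m → ℕ) : List (Fin m) :=
  (List.finRange m).flatMap fun i => List.replicate (σ i) i

/-- `∂^σ f = ∂_0^{σ_0} ⋯ ∂_{m-1}^{σ_{m-1}} f` for a multi-index `σ`. -/
def pderiv (σ : Fin m → ℕ) (f : Euc m → 𝕜) : Euc m → 𝕜 := pdWord (word σ) f

/-- `sup_{x ∈ S} |g(x)|`. -/
def supOn (S : Set (Euc m)) (g : Euc m → 𝕜) : ℝ := ⨆ x : S, ‖g x‖

theorem pd_congr {Ω : Opens (Euc m)} {f g : Euc m → 𝕜} (i : Fin m)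
    (h : EqOn f g Ω) : EqOn (pd i f) (pd i g) Ω := by
  intro x hx
  have : f =ᶠ[𝓝 x] g := by
    filter_upwards [Ω.isOpen.mem_nhds hx] with y hy using h hy
  simp only [pd, this.fderiv_eq]

theorem pd_smooth {Ω : Opens (Euc m)} {f : Euc m → 𝕜} (i : Fin m)
    (h : ContDiffOn ℝ ∞ f Ω) : ContDiffOn ℝ ∞ (pd i f) Ω :=
  (h.fderiv_of_isOpen Ω.isOpen (m := ∞) (by simp)).clm_apply contDiffOn_const

theorem diffAt {Ω : Opens (Euc m)} {f : Euc m → 𝕜} (h : ContDiffOn ℝ ∞ f Ω) {x : Euc m}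
    (hx : x ∈ Ω) : DifferentiableAt ℝ f x :=
  (h.contDiffAt (Ω.isOpen.mem_nhds hx)).differentiableAt (by simp)

theorem pdWord_congr {Ω : Opens (Euc m)} {f g : Euc m → 𝕜} (w : List (Fin m))
    (h : EqOn f g Ω) : EqOn (pdWord w f) (pdWord w g) Ω := by
  induction w with
  | nil => exact h
  | cons i w ih => exact pd_congr i ih

theorem pdWord_smooth {Ω : Opens (Euc m)} {f : Euc m → 𝕜} (w : List (Fin m))
    (h : ContDiffOn ℝ ∞ f Ω) : ContDiffOn ℝ ∞ (pdWord w f) Ω := by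
  induction w with
  | nil => exact h
  | cons i w ih => exact pd_smooth i ih

theorem pdWord_add {Ω : Opens (Euc m)} {f g : Euc m → 𝕜} (w : List (Fin m))
    (hf : ContDiffOn ℝ ∞ f Ω) (hg : ContDiffOn ℝ ∞ g Ω) :
    EqOn (pdWord w (f + g)) (pdWord w f + pdWord w g) Ω := by
  induction w with
  | nil => exact fun _ _ => rfl
  | cons i w ih =>
    intro x hx
    refine (pd_congr i ih hx).trans ?_
    have e := fderiv_add (diffAt (pdWord_smooth w hf) hx) (diffAt (pdWord_smooth w hg) hx)
    exact congrArg (fun T => T (EuclideanSpace.single i 1)) e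

theorem pdWord_neg (w : List (Fin m)) (f : Euc m → 𝕜) : pdWord w (-f) = -pdWord w f := by
  induction w with
  | nil => rfl
  | cons i w ih =>
    funext x
    change fderiv ℝ (pdWord w (-f)) x _ = -(fderiv ℝ (pdWord w f) x _)
    rw [ih, fderiv_neg]; rfl

theorem pdWord_const_zero (w : List (Fin m)) : pdWord w (0 : Euc m → 𝕜) = 0 := by
  induction w with
  | nil => rfl
  | cons i w ih =>
    funext x
    change fderiv ℝ (pdWord w 0) x _ = 0
    rw [ih]; simp

theorem pdWord_one (w : List (Fin m)) :
    pdWord w (1 : Euc m → 𝕜) = 1 ∨ pdWord w (1 : Euc m → 𝕜) = 0 := by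
  induction w with
  | nil => exact Or.inl rfl
  | cons i w ih =>
    right
    funext x
    change fderiv ℝ (pdWord w 1) x _ = 0
    rcases ih with h | h <;> rw [h] <;> simp

/-- All ways to distribute the derivatives in `w` over two factors. -/
def splits {ι : Type*} : List ι → List (List ι × List ι)
  | [] => [([], [])]
  | i :: w => (splits w).flatMap fun p => [(i :: p.1, p.2), (p.1, i :: p.2)]

theorem splits_sublist {ι : Type*} (w : List ι) :
    ∀ p ∈ splits w, p.1.Sublist w ∧ p.2.Sublist w := by
  induction w with
  | nil => simp [splits]
  | cons i w ih =>
    intro p hp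
    simp only [splits, List.mem_flatMap] at hp
    obtain ⟨q, hq, hp⟩ := hp
    obtain ⟨h1, h2⟩ := ih q hq
    simp only [List.mem_cons, List.not_mem_nil, or_false] at hp
    rcases hp with rfl | rfl
    · exact ⟨h1.cons_cons i, h2.cons i⟩
    · exact ⟨h1.cons i, h2.cons_cons i⟩

theorem pd_list_sum {ι : Type*} {Ω : Opens (Euc m)} (L : List ι) (F : ι → Euc m → 𝕜)
    (h : ∀ j ∈ L, ContDiffOn ℝ ∞ (F j) Ω) (i : Fin m) :
    ContDiffOn ℝ ∞ (fun x => (L.map fun j => F j x).sum) Ω ∧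
    EqOn (pd i fun x => (L.map fun j => F j x).sum) (fun x => (L.map fun j => pd i (F j) x).sum)
      Ω := by
  induction L with
  | nil =>
    refine ⟨by simpa using contDiffOn_const, fun x _ => ?_⟩
    simp [pd]
  | cons a L ih =>
    obtain ⟨h1, h2⟩ := ih fun j hj => h j (by simp [hj])
    have ha := h a (by simp)
    simp only [List.map_cons, List.sum_cons]
    refine ⟨ha.add h1, fun x hx => ?_⟩
    have e := fderiv_fun_add (diffAt ha hx) (diffAt h1 hx)
    refine (congrArg (fun T => T (EuclideanSpace.single i 1)) e).trans ?_
    exact congrArg (fun y => pd i (F a) x + y) (h2 hx)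

/-- The Leibniz formula. -/
theorem pdWord_mul {Ω : Opens (Euc m)} {f g : Euc m → 𝕜} (w : List (Fin m))
    (hf : ContDiffOn ℝ ∞ f Ω) (hg : ContDiffOn ℝ ∞ g Ω) :
    EqOn (pdWord w (f * g))
      (fun x => ((splits w).map fun p => pdWord p.1 f x * pdWord p.2 g x).sum) Ω := by
  induction w with
  | nil => intro x _; simp [splits, pdWord]
  | cons i w ih =>
    intro x hx
    refine (pd_congr i ih hx).trans ?_
    have := (pd_list_sum (splits w) (fun p x => pdWord p.1 f x * pdWord p.2 g x)
      (fun p _ => (pdWord_smooth p.1 hf).mul (pdWord_smooth p.2 hg)) i).2 hx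
    refine this.trans ?_
    have key : ∀ p : List (Fin m) × List (Fin m),
        pd i (fun x => pdWord p.1 f x * pdWord p.2 g x) x =
          pdWord (i :: p.1) f x * pdWord p.2 g x + pdWord p.1 f x * pdWord (i :: p.2) g x := by
      intro p
      simp only [pd, pdWord, List.foldr_cons]
      have e := fderiv_fun_mul (diffAt (pdWord_smooth p.1 hf) hx)
        (diffAt (pdWord_smooth p.2 hg) hx)
      simp only [pdWord] at e
      rw [e]
      simp only [_root_.add_apply, _root_.smul_apply, smul_eq_mul]
      ring
    simp only [key, splits]
    induction splits w with
    | nil => simp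
    | cons p L ihL => simp only [List.map_cons, List.sum_cons, List.flatMap_cons, List.map_append,
        List.sum_append, List.map_nil, List.sum_nil, ihL]; ring

theorem word_sorted (σ : Fin m → ℕ) : (word σ).Pairwise (· ≤ ·) := by
  rw [word, List.pairwise_flatMap]
  refine ⟨fun i _ => ?_, ?_⟩
  · exact List.pairwise_replicate.2 (Or.inr le_rfl)
  · refine (List.pairwise_lt_finRange m).imp fun {a b} hab x hx y hy => ?_
    rw [List.eq_of_mem_replicate hx, List.eq_of_mem_replicate hy]
    exact hab.le

theorem count_word (σ : Fin m → ℕ) (i : Fin m) : (word σ).count i = σ i := by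
  rw [word, List.count_flatMap]
  have : (List.map (List.count i ∘ fun j => List.replicate (σ j) j) (List.finRange m)) =
      List.map (fun j => if j = i then σ j else 0) (List.finRange m) := by
    refine List.map_congr_left fun j _ => ?_
    simp [List.count_replicate]
  rw [this, ← List.ofFn_eq_map, List.sum_ofFn]
  simp

theorem sublist_word {σ : Fin m → ℕ} {w : List (Fin m)} (h : w.Sublist (word σ)) :
    ∃ κ : Fin m → ℕ, κ ≤ σ ∧ w = word κ := by
  refine ⟨fun i => w.count i, fun i => ?_, ?_⟩
  · rw [← count_word σ i]; exact h.count_le i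
  · refine List.Perm.eq_of_pairwise (le := (· ≤ ·)) (fun a b _ _ h1 h2 => le_antisymm h1 h2)
      ((word_sorted σ).sublist h) (word_sorted _) ?_
    rw [List.perm_iff_count]
    intro i
    rw [count_word]

theorem supOn_nonneg (S : Set (Euc m)) (g : Euc m → 𝕜) : 0 ≤ supOn S g :=
  Real.iSup_nonneg fun _ => norm_nonneg _

/-- Boundedness of a smooth function on a subset of a compact subset. -/
theorem bdd_of_smooth {Ω : Opens (Euc m)} {g : Euc m → 𝕜} (hg : ContDiffOn ℝ ∞ g Ω)
    {S : Set (Euc m)} (hS : IsCompact (closure S)) (hSΩ : closure S ⊆ Ω) :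
    BddAbove (range fun x : S => ‖g x‖) := by
  obtain ⟨C, hC⟩ := (hS.image_of_continuousOn (hg.continuousOn.mono hSΩ).norm).bddAbove
  refine ⟨C, ?_⟩
  rintro _ ⟨x, rfl⟩
  exact hC ⟨x, subset_closure x.2, rfl⟩

theorem le_supOn {Ω : Opens (Euc m)} {g : Euc m → 𝕜} (hg : ContDiffOn ℝ ∞ g Ω)
    {S : Set (Euc m)} (hS : IsCompact (closure S)) (hSΩ : closure S ⊆ Ω) {x : Euc m}
    (hx : x ∈ S) : ‖g x‖ ≤ supOn S g :=
  le_ciSup (bdd_of_smooth hg hS hSΩ) ⟨x, hx⟩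

theorem supOn_le {S : Set (Euc m)} {g : Euc m → 𝕜} {C : ℝ} (hC : 0 ≤ C)
    (h : ∀ x ∈ S, ‖g x‖ ≤ C) : supOn S g ≤ C :=
  Real.iSup_le (fun x => h x x.2) hC

theorem supOn_pdWord_add_le {Ω : Opens (Euc m)} {f g : Euc m → 𝕜} (w : List (Fin m))
    (hf : ContDiffOn ℝ ∞ f Ω) (hg : ContDiffOn ℝ ∞ g Ω)
    {S : Set (Euc m)} (hS : IsCompact (closure S)) (hSΩ : closure S ⊆ Ω) :
    supOn S (pdWord w (f + g)) ≤ supOn S (pdWord w f) + supOn S (pdWord w g) := by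
  refine supOn_le (add_nonneg (supOn_nonneg _ _) (supOn_nonneg _ _)) fun x hx => ?_
  rw [pdWord_add w hf hg (hSΩ (subset_closure hx))]
  exact (norm_add_le _ _).trans (add_le_add (le_supOn (pdWord_smooth w hf) hS hSΩ hx)
    (le_supOn (pdWord_smooth w hg) hS hSΩ hx))

theorem supOn_pdWord_neg (f : Euc m → 𝕜) (w : List (Fin m)) (S : Set (Euc m)) :
    supOn S (pdWord w (-f)) = supOn S (pdWord w f) := by
  simp [supOn, pdWord_neg]

theorem supOn_pdWord_mul_le {Ω : Opens (Euc m)} {f g : Euc m → 𝕜} (w : List (Fin m))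
    (hf : ContDiffOn ℝ ∞ f Ω) (hg : ContDiffOn ℝ ∞ g Ω)
    {S : Set (Euc m)} (hS : IsCompact (closure S)) (hSΩ : closure S ⊆ Ω) :
    supOn S (pdWord w (f * g)) ≤
      ((splits w).map fun p => supOn S (pdWord p.1 f) * supOn S (pdWord p.2 g)).sum := by
  have hnn : ∀ L : List (List (Fin m) × List (Fin m)),
      0 ≤ (L.map fun p => supOn S (pdWord p.1 f) * supOn S (pdWord p.2 g)).sum := by
    intro L
    refine List.sum_nonneg fun y hy => ?_
    obtain ⟨p, _, rfl⟩ := List.mem_map.1 hy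
    exact mul_nonneg (supOn_nonneg _ _) (supOn_nonneg _ _)
  refine supOn_le (hnn _) fun x hx => ?_
  rw [pdWord_mul w hf hg (hSΩ (subset_closure hx))]
  induction splits w with
  | nil => simp
  | cons p L ih =>
    simp only [List.map_cons, List.sum_cons]
    refine (norm_add_le _ _).trans (add_le_add ?_ ih)
    rw [norm_mul]
    exact mul_le_mul (le_supOn (pdWord_smooth _ hf) hS hSΩ hx)
      (le_supOn (pdWord_smooth _ hg) hS hSΩ hx) (norm_nonneg _) (supOn_nonneg _ _)

theorem supOn_mono {Ω : Opens (Euc m)} {g : Euc m → 𝕜} (hg : ContDiffOn ℝ ∞ g Ω)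
    {S T : Set (Euc m)} (hST : S ⊆ T) (hT : IsCompact (closure T)) (hTΩ : closure T ⊆ Ω) :
    supOn S g ≤ supOn T g :=
  supOn_le (supOn_nonneg _ _) fun _ hx => le_supOn hg hT hTΩ (hST hx)

end Deriv

/-! ### The full Colombeau algebra -/

section Algebra

variable {𝕜 : Type*} [RCLike 𝕜] {m : ℕ}

theorem closure_eq_of_compact {K : Set (Euc m)} (hK : IsCompact K) : closure K = K :=
  hK.isClosed.closure_eq

variable (𝕜) in
/-- The ring `𝓔_M[Ω]` of moderate families `u(φ, x)`, `φ ∈ A₀`, smooth in `x ∈ Ω`. The members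
are total functions of `x`; their values outside `Ω` are irrelevant, because two families that
agree on `Ω` differ by a null family (see `NF`). -/
def EM (Ω : Opens (Euc m)) : Subring (A0 𝕜 m → Euc m → 𝕜) where
  carrier := {u | (∀ φ, ContDiffOn ℝ ∞ (u φ) Ω) ∧
    ∀ K : Set (Euc m), IsCompact K → K ⊆ Ω → ∀ σ : Fin m → ℕ,
      Moderate fun φ => supOn K (pderiv σ (u φ))}
  mul_mem' := by
    rintro u v ⟨hu, hu'⟩ ⟨hv, hv'⟩
    refine ⟨fun φ => (hu φ).mul (hv φ), fun K hK hKΩ σ => ?_⟩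
    have hc := closure_eq_of_compact hK
    have := Moderate.list_sum (splits (word σ))
      (fun p φ => supOn K (pdWord p.1 (u φ)) * supOn K (pdWord p.2 (v φ))) (fun p hp => by
        obtain ⟨h1, h2⟩ := splits_sublist _ p hp
        obtain ⟨κ, -, hκ⟩ := sublist_word h1
        obtain ⟨τ, -, hτ⟩ := sublist_word h2
        rw [hκ, hτ]
        exact (hu' K hK hKΩ κ).mul (hv' K hK hKΩ τ))
    refine this.mono fun φ => ?_
    rw [abs_of_nonneg (supOn_nonneg _ _)]
    exact (supOn_pdWord_mul_le _ (hu φ) (hv φ) (hc.symm ▸ hK) (hc.symm ▸ hKΩ)).trans (le_abs_self _)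
  one_mem' := by
    refine ⟨fun φ => contDiffOn_const, fun K hK hKΩ σ => ?_⟩
    refine (moderate_const 1).mono fun φ => ?_
    rw [abs_of_nonneg (supOn_nonneg _ _), abs_one]
    refine supOn_le zero_le_one fun x _ => ?_
    rcases pdWord_one (𝕜 := 𝕜) (word σ) with h | h
    · exact (by simp [pderiv, h] : ‖pderiv σ (1 : Euc m → 𝕜) x‖ ≤ 1)
    · exact (by simp [pderiv, h] : ‖pderiv σ (1 : Euc m → 𝕜) x‖ ≤ 1)
  add_mem' := by
    rintro u v ⟨hu, hu'⟩ ⟨hv, hv'⟩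
    refine ⟨fun φ => (hu φ).add (hv φ), fun K hK hKΩ σ => ?_⟩
    have hc := closure_eq_of_compact hK
    refine ((hu' K hK hKΩ σ).add (hv' K hK hKΩ σ)).mono fun φ => ?_
    rw [abs_of_nonneg (supOn_nonneg _ _)]
    exact (supOn_pdWord_add_le _ (hu φ) (hv φ) (hc.symm ▸ hK) (hc.symm ▸ hKΩ)).trans (le_abs_self _)
  zero_mem' := by
    refine ⟨fun φ => contDiffOn_const, fun K hK hKΩ σ => ?_⟩
    refine (moderate_const 0).mono fun φ => ?_
    have : supOn K (pderiv σ (0 : Euc m → 𝕜)) = 0 := by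
      simp [supOn, pderiv, pdWord_const_zero]
    exact (congrArg abs this).le
  neg_mem' := by
    rintro u ⟨hu, hu'⟩
    refine ⟨fun φ => (hu φ).neg, fun K hK hKΩ σ => (hu' K hK hKΩ σ).mono fun φ => ?_⟩
    exact (congrArg abs (supOn_pdWord_neg (u φ) (word σ) K)).le

variable (𝕜) in
/-- The ideal `𝓝[Ω]` of null families. -/
def NF (Ω : Opens (Euc m)) : Ideal (EM 𝕜 Ω) where
  carrier := {u | ∀ K : Set (Euc m), IsCompact K → K ⊆ Ω → ∀ σ : Fin m → ℕ,
    Negligible fun φ => supOn K (pderiv σ (u.1 φ))}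
  add_mem' := by
    intro u v hu hv K hK hKΩ σ
    have hc := closure_eq_of_compact hK
    refine ((hu K hK hKΩ σ).add (hv K hK hKΩ σ)).mono fun φ => ?_
    rw [abs_of_nonneg (supOn_nonneg _ _)]
    exact (supOn_pdWord_add_le _ (u.2.1 φ) (v.2.1 φ) (hc.symm ▸ hK) (hc.symm ▸ hKΩ)).trans
      (le_abs_self _)
  zero_mem' := by
    intro K hK hKΩ σ
    refine negligible_zero.mono fun φ => ?_
    have : supOn K (pderiv σ (0 : Euc m → 𝕜)) = 0 := by
      simp [supOn, pderiv, pdWord_const_zero]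
    exact (congrArg abs this).le
  smul_mem' := by
    intro u v hv K hK hKΩ σ
    have hc := closure_eq_of_compact hK
    have := Negligible.list_sum (splits (word σ))
      (fun p φ => supOn K (pdWord p.1 (u.1 φ)) * supOn K (pdWord p.2 (v.1 φ))) (fun p hp => by
        obtain ⟨h1, h2⟩ := splits_sublist _ p hp
        obtain ⟨κ, -, hκ⟩ := sublist_word h1
        obtain ⟨τ, -, hτ⟩ := sublist_word h2
        rw [hκ, hτ]
        exact (u.2.2 K hK hKΩ κ).mul_negligible (hv K hK hKΩ τ))
    refine this.mono fun φ => ?_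
    rw [abs_of_nonneg (supOn_nonneg _ _)]
    exact (supOn_pdWord_mul_le _ (u.2.1 φ) (v.2.1 φ) (hc.symm ▸ hK) (hc.symm ▸ hKΩ)).trans
      (le_abs_self _)

variable (𝕜) in
/-- The full Colombeau algebra `𝓖(Ω) = 𝓔_M[Ω] / 𝓝[Ω]`. -/
abbrev G (Ω : Opens (Euc m)) : Type _ := EM 𝕜 Ω ⧸ NF 𝕜 Ω

theorem EM_anti {Ω V : Opens (Euc m)} (h : V ≤ Ω) : EM 𝕜 Ω ≤ EM 𝕜 V :=
  fun _ hu => ⟨fun φ => (hu.1 φ).mono h, fun K hK hKV σ => hu.2 K hK (hKV.trans h) σ⟩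

/-- The restriction map `f ↦ f|_V` from `𝓖(Ω)` to `𝓖(V)`, for `V ⊆ Ω` open. -/
def restrict {Ω V : Opens (Euc m)} (h : V ≤ Ω) : G 𝕜 Ω →+* G 𝕜 V :=
  Ideal.quotientMap (NF 𝕜 V) (Subring.inclusion (EM_anti h))
    (fun _ hu K hK hKV σ => hu K hK (hKV.trans h) σ)

/-- The support of `f ∈ 𝓖(Ω)`: the points of `Ω` without an open neighbourhood `V ⊆ Ω` on which
`f` vanishes. -/
def supp {Ω : Opens (Euc m)} (f : G 𝕜 Ω) : Set (Euc m) :=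
  {x | x ∈ Ω ∧ ∀ (V : Opens (Euc m)) (h : V ≤ Ω), x ∈ V → restrict h f ≠ 0}

variable (𝕜) in
/-- `𝓖_c(Ω)`: the generalized functions whose support is a compact subset of `Ω`. -/
def Gc (Ω : Opens (Euc m)) : Set (G 𝕜 Ω) := {f | IsCompact (supp f)}

/-! ### The topology -/

/-- `‖f‖_{S,κ} = cl(φ ↦ sup_{x ∈ S} |∂^κ u(φ, x)|)`, where `u` is any representative of `f`, for a
set `S` whose closure is a compact subset of `Ω`. -/
def gnorm {Ω : Opens (Euc m)} (S : Set (Euc m)) (hS : IsCompact (closure S) ∧ closure S ⊆ Ω)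
    (κ : Fin m → ℕ) (f : G 𝕜 Ω) : GenReal 𝕜 m :=
  Quotient.liftOn' f
    (fun u => GenReal.cl (fun φ => supOn S (pderiv κ (u.1 φ)))
      ((u.2.2 _ hS.1 hS.2 κ).mono fun φ => by
        rw [abs_of_nonneg (supOn_nonneg _ _), abs_of_nonneg (supOn_nonneg _ _)]
        exact supOn_mono (pdWord_smooth _ (u.2.1 φ)) subset_closure
          (by rw [closure_closure]; exact hS.1)
          (by rw [closure_closure]; exact hS.2)))
    (by
      intro u v huv
      have huv' : u - v ∈ NF 𝕜 Ω := (Submodule.quotientRel_def _).1 huv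
      rw [GenReal.cl, GenReal.cl, Ideal.Quotient.eq]
      refine (huv' _ hS.1 hS.2 κ).mono fun φ => ?_
      have hS1 : IsCompact (closure (closure S)) := by rw [closure_closure]; exact hS.1
      have hS2 : closure (closure S) ⊆ (Ω : Set (Euc m)) := by rw [closure_closure]; exact hS.2
      have hd : ContDiffOn ℝ ∞ (u.1 φ - v.1 φ) Ω := (u.2.1 φ).sub (v.2.1 φ)
      have e1 := supOn_mono (pdWord_smooth (word κ) hd) subset_closure hS1 hS2
      have e2 := supOn_pdWord_add_le (word κ) hd (v.2.1 φ) hS.1 hS.2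
      have e3 := supOn_pdWord_add_le (f := -(u.1 φ - v.1 φ)) (word κ) hd.neg (u.2.1 φ) hS.1 hS.2
      rw [sub_add_cancel] at e2
      rw [show -(u.1 φ - v.1 φ) + u.1 φ = v.1 φ by abel, supOn_pdWord_neg] at e3
      refine le_trans ?_ (le_abs_self _)
      change |supOn S (pdWord (word κ) (u.1 φ)) - supOn S (pdWord (word κ) (v.1 φ))| ≤
        supOn (closure S) (pdWord (word κ) (u.1 φ - v.1 φ))
      rw [abs_le]
      constructor <;> linarith)

theorem gnorm_mk {Ω : Opens (Euc m)} (S : Set (Euc m))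
    (hS : IsCompact (closure S) ∧ closure S ⊆ Ω) (κ : Fin m → ℕ) (u : EM 𝕜 Ω) :
    ∃ h, gnorm S hS κ (Ideal.Quotient.mk (NF 𝕜 Ω) u) =
      GenReal.cl (fun φ => supOn S (pderiv κ (u.1 φ))) h := ⟨_, rfl⟩

theorem gnorm_add_le {Ω : Opens (Euc m)} (S : Set (Euc m))
    (hS : IsCompact (closure S) ∧ closure S ⊆ Ω) (κ : Fin m → ℕ) (f g : G 𝕜 Ω) :
    gnorm S hS κ (f + g) ≤ gnorm S hS κ f + gnorm S hS κ g := by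
  obtain ⟨u, rfl⟩ := Ideal.Quotient.mk_surjective f
  obtain ⟨v, rfl⟩ := Ideal.Quotient.mk_surjective g
  rw [← map_add]
  obtain ⟨h, e⟩ := gnorm_mk S hS κ (u + v)
  obtain ⟨h1, e1⟩ := gnorm_mk S hS κ u
  obtain ⟨h2, e2⟩ := gnorm_mk S hS κ v
  rw [e, e1, e2]
  exact GenReal.cl_le_cl h (h1.add h2) fun φ => ⟨1, one_pos, fun ε hε _ =>
    supOn_pdWord_add_le _ (u.2.1 _) (v.2.1 _) hS.1 hS.2⟩

theorem gnorm_neg {Ω : Opens (Euc m)} (S : Set (Euc m))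
    (hS : IsCompact (closure S) ∧ closure S ⊆ Ω) (κ : Fin m → ℕ) (f : G 𝕜 Ω) :
    gnorm S hS κ (-f) = gnorm S hS κ f := by
  obtain ⟨u, rfl⟩ := Ideal.Quotient.mk_surjective f
  rw [← map_neg]
  obtain ⟨h, e⟩ := gnorm_mk S hS κ (-u)
  obtain ⟨h1, e1⟩ := gnorm_mk S hS κ u
  rw [e, e1]
  congr 1
  funext φ
  exact supOn_pdWord_neg _ _ _

theorem gnorm_zero_le {Ω : Opens (Euc m)} (S : Set (Euc m))
    (hS : IsCompact (closure S) ∧ closure S ⊆ Ω) (κ : Fin m → ℕ) (r : ℕ) :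
    gnorm S hS κ (0 : G 𝕜 Ω) ≤ alpha 𝕜 m r := by
  rw [← map_zero (Ideal.Quotient.mk (NF 𝕜 Ω))]
  obtain ⟨h, e⟩ := gnorm_mk S hS κ (0 : EM 𝕜 Ω)
  rw [e]
  refine GenReal.cl_le_cl h _ fun φ => ⟨1, one_pos, fun ε hε _ => ?_⟩
  have : supOn S (pderiv κ (0 : Euc m → 𝕜)) = 0 := by
    simp [supOn, pderiv, pdWord_const_zero]
  exact this.le.trans (pow_nonneg (A0.diamSupp_nonneg _) r)

theorem gnorm_mono {Ω : Opens (Euc m)} {S T : Set (Euc m)} (hST : S ⊆ T)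
    (hS : IsCompact (closure S) ∧ closure S ⊆ Ω) (hT : IsCompact (closure T) ∧ closure T ⊆ Ω)
    (κ : Fin m → ℕ) (f : G 𝕜 Ω) : gnorm S hS κ f ≤ gnorm T hT κ f := by
  obtain ⟨u, rfl⟩ := Ideal.Quotient.mk_surjective f
  obtain ⟨h1, e1⟩ := gnorm_mk S hS κ u
  obtain ⟨h2, e2⟩ := gnorm_mk T hT κ u
  rw [e1, e2]
  exact GenReal.cl_le_cl h1 h2 fun φ => ⟨1, one_pos, fun ε hε _ =>
    supOn_mono (pdWord_smooth _ (u.2.1 _)) hST hT.1 hT.2⟩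

/-- Exhaustive sequences `(Ω_l)` of open subsets of `Ω`: the closure of `Ω_l` is a compact subset of
`Ω_{l+1}`, and the union of the `Ω_l` is `Ω`. -/
structure IsExhaustion (Ω : Opens (Euc m)) (S : ℕ → Opens (Euc m)) : Prop where
  isCompact_closure : ∀ l, IsCompact (closure (S l : Set (Euc m)))
  closure_subset : ∀ l, closure (S l : Set (Euc m)) ⊆ S (l + 1)
  iUnion_eq : ⋃ l, (S l : Set (Euc m)) = Ω

theorem IsExhaustion.relCompact {Ω : Opens (Euc m)} {S : ℕ → Opens (Euc m)}
    (h : IsExhaustion Ω S) (l : ℕ) :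
    IsCompact (closure (S l : Set (Euc m))) ∧ closure (S l : Set (Euc m)) ⊆ Ω :=
  ⟨h.isCompact_closure l, (h.closure_subset l).trans
    ((subset_iUnion (fun l => (S l : Set (Euc m))) (l + 1)).trans h.iUnion_eq.subset)⟩

theorem IsExhaustion.mono {Ω : Opens (Euc m)} {S : ℕ → Opens (Euc m)}
    (h : IsExhaustion Ω S) {k l : ℕ} (hkl : k ≤ l) : (S k : Set (Euc m)) ⊆ S l :=
  monotone_nat_of_le_succ (f := fun l => (S l : Set (Euc m)))
    (fun l => subset_closure.trans (h.closure_subset l)) hkl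

variable (𝕜) in
/-- `W^σ_{l,r} = {f ∈ 𝓖(Ω) : ‖f‖_{Ω_l,κ} ≤ α_r for all κ ≤ σ}`. -/
def W {Ω : Opens (Euc m)} {S : ℕ → Opens (Euc m)} (hS : IsExhaustion Ω S) (σ : Fin m → ℕ)
    (l r : ℕ) : Set (G 𝕜 Ω) :=
  {f | ∀ κ ≤ σ, gnorm (S l) (hS.relCompact l) κ f ≤ alpha 𝕜 m r}

theorem W_anti {Ω : Opens (Euc m)} {S : ℕ → Opens (Euc m)} (hS : IsExhaustion Ω S)
    {σ σ' : Fin m → ℕ} {l l' r r' : ℕ} (h1 : σ ≤ σ') (h2 : l ≤ l') (h3 : r ≤ r') :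
    W 𝕜 hS σ' l' r' ⊆ W 𝕜 hS σ l r := fun f hf κ hκ =>
  GenReal.le_trans (gnorm_mono (hS.mono h2) _ _ κ f)
    (GenReal.le_trans (hf κ (hκ.trans h1)) (alpha_anti h3))

variable (𝕜) in
/-- The filter basis of the sets `W^σ_{l,r}` with `σ ∈ ℕ^m`, `l ∈ ℕ` and `r ∈ ℕ`, `r ≥ 1`. -/
@[reducible]
def basisW {Ω : Opens (Euc m)} {S : ℕ → Opens (Euc m)} (hS : IsExhaustion Ω S) :
    AddGroupFilterBasis (G 𝕜 Ω) :=
  addGroupFilterBasisOfComm {U | ∃ (σ : Fin m → ℕ) (l r : ℕ), 1 ≤ r ∧ U = W 𝕜 hS σ l r}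
    ⟨_, 0, 0, 1, le_rfl, rfl⟩
    (by
      rintro _ _ ⟨σ, l, r, hr, rfl⟩ ⟨σ', l', r', hr', rfl⟩
      exact ⟨_, ⟨σ ⊔ σ', max l l', max r r', hr.trans (le_max_left _ _), rfl⟩, subset_inter
        (W_anti hS le_sup_left (le_max_left _ _) (le_max_left _ _))
        (W_anti hS le_sup_right (le_max_right _ _) (le_max_right _ _))⟩)
    (by
      rintro _ ⟨σ, l, r, -, rfl⟩ κ -
      exact gnorm_zero_le _ _ _ _)
    (by
      rintro _ ⟨σ, l, r, hr, rfl⟩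
      refine ⟨_, ⟨σ, l, r + 1, by omega, rfl⟩, ?_⟩
      rintro _ ⟨f, hf, g, hg, rfl⟩ κ hκ
      exact GenReal.le_trans (gnorm_add_le _ _ _ _ _)
        (GenReal.le_trans (GenReal.add_le_add (hf κ hκ) (hg κ hκ)) (alpha_succ_add_le r)))
    (by
      rintro _ ⟨σ, l, r, hr, rfl⟩
      refine ⟨_, ⟨σ, l, r, hr, rfl⟩, fun f hf κ hκ => ?_⟩
      change gnorm _ _ κ (-f) ≤ _
      rw [gnorm_neg]
      exact hf κ hκ)

variable (𝕜) in
/-- The topology `𝓣_Ω` on `𝓖(Ω)`: the translation invariant topology for which the sets `W^σ_{l,r}`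
are a fundamental system of neighbourhoods of `0`. -/
@[reducible]
def topologyG {Ω : Opens (Euc m)} {S : ℕ → Opens (Euc m)} (hS : IsExhaustion Ω S) :
    TopologicalSpace (G 𝕜 Ω) := (basisW 𝕜 hS).topology

end Algebra

end Colombeau

end

noncomputable section

namespace Colombeau

variable {𝕜 : Type*} [RCLike 𝕜] {m : ℕ}

/-! Both halves rest on the local nature of the algebra: a representative that is identically zero
on an open set has zero derivatives there, so it restricts to zero and its seminorms over that set
are zero.

Ideal: the complement of `supp f` in `Ω` is a union of open sets, so `supp f` is relatively closed
in `Ω`. A relatively closed set contained in a compact subset of `Ω` is compact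
(`isCompact_supp_of_subset`). Compactness of supports is therefore inherited through `supp (f + g) ⊆
supp f ∪ supp g` and `supp (f * g) ⊆ supp g`, which hold because restriction is a ring homomorphism.

Density: a basic neighbourhood `f + W^σ_{l,r}` constrains only what happens on `Ω_l`. Let `u`
represent `f` and let `χ` be a smooth cutoff, equal to `1` on the closure of `Ω_l` and to `0` off
`Ω_{l+1}`. The class of `χ u` has compact support, and `χ u - u` vanishes identically on `Ω_l`. Its
seminorms there are exactly zero, hence below `α_r` for every `r` and every order of derivation. No
growth estimate in `ε` is needed beyond the moderateness of `χ u`. -/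

/-! ### Families vanishing on an open set. -/

/-- Derivatives at a point of `V` depend only on the germ there, because `V` is open. Compactness of
`K` plays no role, so `K` may be `V` itself, as in `mk_mem_W_of_eqOn_zero`. -/
theorem supOn_pderiv_eq_zero {V : Opens (Euc m)} {f : Euc m → 𝕜} (hf : EqOn f 0 V)
    {K : Set (Euc m)} (hK : K ⊆ V) (σ : Fin m → ℕ) : supOn K (pderiv σ f) = 0 := by
  refine le_antisymm (supOn_le le_rfl fun x hx => ?_) (supOn_nonneg _ _)
  have h : pderiv σ f x = pdWord (word σ) 0 x := pdWord_congr (word σ) hf (hK hx)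
  rw [h, pdWord_const_zero]
  simp

theorem mk_mem_W_of_eqOn_zero {Ω : Opens (Euc m)} {S : ℕ → Opens (Euc m)}
    (hS : IsExhaustion Ω S) (u : EM 𝕜 Ω) {l : ℕ} (hu : ∀ φ, EqOn (u.1 φ) 0 (S l))
    (σ : Fin m → ℕ) (r : ℕ) : Ideal.Quotient.mk (NF 𝕜 Ω) u ∈ W 𝕜 hS σ l r := by
  intro κ _
  obtain ⟨h, e⟩ := gnorm_mk (S l : Set (Euc m)) (hS.relCompact l) κ u
  rw [e]
  -- The comparison is `0 ≤ i(φ_ε)^r`, valid for every `ε`; the threshold `1` is arbitrary.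
  refine GenReal.cl_le_cl h _ fun φ => ⟨1, one_pos, fun ε hε _ => ?_⟩
  rw [supOn_pderiv_eq_zero (hu _) subset_rfl]
  exact pow_nonneg (A0.diamSupp_nonneg _) r

theorem restrict_mk_eq_zero {Ω V : Opens (Euc m)} (h : V ≤ Ω) (u : EM 𝕜 Ω)
    (hu : ∀ φ, EqOn (u.1 φ) 0 V) : restrict h (Ideal.Quotient.mk (NF 𝕜 Ω) u) = 0 := by
  refine Ideal.Quotient.eq_zero_iff_mem.2 (?_ : Subring.inclusion (EM_anti h) u ∈ NF 𝕜 V)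
  intro K _ hKV σ
  exact negligible_zero.mono fun φ => (congrArg abs (supOn_pderiv_eq_zero (hu φ) hKV σ)).le

/-- A smooth function, as a family that does not depend on `φ`. -/
def constFamily {Ω : Opens (Euc m)} (g : Euc m → 𝕜) (hg : ContDiffOn ℝ ∞ g Ω) : EM 𝕜 Ω :=
  ⟨fun _ => g, fun _ => hg, fun _ _ _ _ => moderate_const _⟩

/-! ### Supports and the ideal. -/

theorem restrict_restrict {Ω V U : Opens (Euc m)} (hV : V ≤ Ω) (hU : U ≤ V) (f : G 𝕜 Ω) :
    restrict hU (restrict hV f) = restrict (hU.trans hV) f := by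
  obtain ⟨u, rfl⟩ := Ideal.Quotient.mk_surjective f
  -- Restriction keeps the representative and changes only the null ideal, so both sides are the
  -- class of the same `u`.
  rfl

/-- This form shows that the support is relatively closed in `Ω`. Only openness of the union
matters: whether `f` vanishes on the whole union, a sheaf property, is not used. -/
theorem supp_eq_diff {Ω : Opens (Euc m)} (f : G 𝕜 Ω) :
    supp f = (Ω : Set (Euc m)) \ ⋃ V : {V : Opens (Euc m) // ∃ h : V ≤ Ω, restrict h f = 0}, (V.1 : Set _) := by
  ext x
  simp only [supp, mem_ofPred_eq, Set.mem_sdiff, SetLike.mem_coe, mem_iUnion, Subtype.exists, not_exists]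
  exact and_congr_right fun _ =>
    ⟨fun H V ⟨h, e⟩ hx => H V h hx e, fun H V h hx e => H V ⟨h, e⟩ hx⟩

/-- Removing the same open set from `K` instead of from `Ω` leaves the same support, and a compact
set minus an open set is compact. -/
theorem isCompact_supp_of_subset {Ω : Opens (Euc m)} {f : G 𝕜 Ω} {K : Set (Euc m)}
    (hK : IsCompact K) (hKΩ : K ⊆ Ω) (h : supp f ⊆ K) : IsCompact (supp f) := by
  have e : supp f =
      K \ ⋃ V : {V : Opens (Euc m) // ∃ h : V ≤ Ω, restrict h f = 0}, (V.1 : Set _) := by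
    refine Subset.antisymm (fun x hx => ⟨h hx, ?_⟩) ?_
    · rw [supp_eq_diff] at hx
      exact hx.2
    · rw [supp_eq_diff]
      -- This is where `K ⊆ Ω` enters: without it `K` minus the open set could contain points
      -- outside `Ω`.
      exact sdiff_subset_sdiff_left hKΩ
  rw [e]
  exact hK.diff (isOpen_iUnion fun V => V.1.isOpen)

theorem supp_zero {Ω : Opens (Euc m)} : supp (0 : G 𝕜 Ω) = ∅ :=
  eq_empty_of_forall_notMem fun _ hx => hx.2 Ω le_rfl hx.1 (map_zero _)

theorem supp_mul_subset {Ω : Opens (Euc m)} (f g : G 𝕜 Ω) : supp (f * g) ⊆ supp g :=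
  fun _ hx => ⟨hx.1, fun V h hxV e => hx.2 V h hxV (by rw [map_mul, e, mul_zero])⟩

/-- A point outside both supports has a neighbourhood on which `f` vanishes and one on which `g`
does; the sum vanishes on their intersection. -/
theorem supp_add_subset {Ω : Opens (Euc m)} (f g : G 𝕜 Ω) :
    supp (f + g) ⊆ supp f ∪ supp g := by
  intro x hx
  by_contra hn
  simp only [supp, mem_union, mem_ofPred_eq, not_or, not_and, not_forall, not_not] at hn
  obtain ⟨V, hV, hxV, eV⟩ := hn.1 hx.1
  obtain ⟨U, hU, hxU, eU⟩ := hn.2 hx.1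
  refine hx.2 (V ⊓ U) (inf_le_left.trans hV) ⟨hxV, hxU⟩ ?_
  have hf : restrict (inf_le_left.trans hV : V ⊓ U ≤ Ω) f = 0 := by
    rw [← restrict_restrict hV inf_le_left f, eV]
    exact RingHom.map_zero _
  have hg : restrict (inf_le_left.trans hV : V ⊓ U ≤ Ω) g = 0 := by
    rw [← restrict_restrict hU inf_le_right g, eU]
    exact RingHom.map_zero _
  rw [RingHom.map_add, hf, hg, add_zero]

variable (𝕜) in
/-- `𝓖_c(Ω)` as an ideal of `𝓖(Ω)`. -/
def GcIdeal (Ω : Opens (Euc m)) : Ideal (G 𝕜 Ω) where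
  carrier := Gc 𝕜 Ω
  add_mem' {f g} hf hg := isCompact_supp_of_subset (IsCompact.union hf hg)
    (union_subset (fun _ hx => hx.1) fun _ hx => hx.1) (supp_add_subset f g)
  zero_mem' := by
    change IsCompact (supp (0 : G 𝕜 Ω))
    rw [supp_zero]
    exact isCompact_empty
  smul_mem' f _ hg := isCompact_supp_of_subset hg (fun _ hx => hx.1) (supp_mul_subset f _)

/-! ### Cutoffs and density. -/

/-- A smooth function that is `1` on a closed set and vanishes outside an open neighbourhood. -/
theorem exists_cutoff {C U : Set (Euc m)} (hC : IsClosed C) (hU : IsOpen U) (h : C ⊆ U) :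
    ∃ χ : Euc m → 𝕜, ContDiff ℝ ∞ χ ∧ EqOn χ 0 Uᶜ ∧ EqOn χ 1 C := by
  obtain ⟨χ, h0, h1, -⟩ := exists_contMDiffMap_zero_one_of_isClosed (n := (⊤ : ℕ∞))
    (modelWithCornersSelf ℝ (Euc m)) hU.isClosed_compl hC
    (disjoint_compl_left_iff_subset.2 h)
  -- The smooth Urysohn function is real-valued; composing with the continuous linear embedding of
  -- `ℝ` in `𝕜` keeps it smooth.
  refine ⟨fun x => (χ x : 𝕜), (RCLike.ofRealCLM (K := 𝕜)).contDiff.comp χ.contMDiff.contDiff,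
    fun x hx => ?_, fun x hx => ?_⟩
  · simp [h0 hx]
  · simp [h1 hx]

theorem mul_constFamily_mem_Gc {Ω : Opens (Euc m)} {K : Set (Euc m)} (hK : IsCompact K)
    (hKΩ : K ⊆ Ω) (u : EM 𝕜 Ω) {χ : Euc m → 𝕜} (hχ : ContDiffOn ℝ ∞ χ Ω) (h0 : EqOn χ 0 Kᶜ) :
    Ideal.Quotient.mk (NF 𝕜 Ω) (u * constFamily χ hχ) ∈ Gc 𝕜 Ω := by
  refine isCompact_supp_of_subset hK hKΩ fun x hx => by_contra fun hxK => ?_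
  -- Since `K` is closed, `Ω \ K` is an open neighbourhood of `x`, and the product vanishes
  -- identically on it.
  refine hx.2 (Ω ⊓ ⟨Kᶜ, hK.isClosed.isOpen_compl⟩) inf_le_left ⟨hx.1, hxK⟩
    (restrict_mk_eq_zero _ _ fun φ y hy => ?_)
  change u.1 φ y * χ y = 0
  rw [h0 hy.2, Pi.zero_apply, mul_zero]

theorem dense_Gc {Ω : Opens (Euc m)} {S : ℕ → Opens (Euc m)} (hS : IsExhaustion Ω S) :
    @Dense (G 𝕜 Ω) (topologyG 𝕜 hS) (Gc 𝕜 Ω) := by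
  let := topologyG 𝕜 hS
  intro f
  rw [mem_closure_iff_nhds_basis' ((basisW 𝕜 hS).nhds_hasBasis f)]
  rintro _ ⟨σ, l, r, -, rfl⟩
  obtain ⟨u, rfl⟩ := Ideal.Quotient.mk_surjective f
  obtain ⟨χ, hχ, h0, h1⟩ :=
    exists_cutoff (𝕜 := 𝕜) isClosed_closure (S (l + 1)).isOpen (hS.closure_subset l)
  -- The approximant is written as `f` plus the class of `χ u - u`, which lies in the given
  -- `W^σ_{l,r}`. Its support is controlled by the closure of `Ω_{l+1}`, a compact subset of `Ω`
  -- because it lies in `Ω_{l+2}`.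
  refine ⟨_, ⟨Ideal.Quotient.mk (NF 𝕜 Ω) (u * constFamily χ hχ.contDiffOn - u),
    mk_mem_W_of_eqOn_zero hS _ (fun φ x hx => ?_) σ r, ?_⟩,
    mul_constFamily_mem_Gc (hS.isCompact_closure (l + 1)) (hS.relCompact (l + 1)).2 u
      hχ.contDiffOn (h0.mono (compl_subset_compl.2 subset_closure))⟩
  · change u.1 φ x * χ x - u.1 φ x = 0
    rw [h1 (subset_closure hx), Pi.one_apply, mul_one, sub_self]
  · change _ + _ = _
    rw [map_sub, add_sub_cancel]

end Colombeau

end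

theorem proposition1p17 {𝕜 : Type*} [RCLike 𝕜] {m : ℕ}
    (Ω : TopologicalSpace.Opens (Colombeau.Euc m)) (S : ℕ → TopologicalSpace.Opens (Colombeau.Euc m))
    (hS : Colombeau.IsExhaustion Ω S) :
    (∃ J : Ideal (Colombeau.G 𝕜 Ω), (J : Set (Colombeau.G 𝕜 Ω)) = Colombeau.Gc 𝕜 Ω) ∧
      @Dense (Colombeau.G 𝕜 Ω) (Colombeau.topologyG 𝕜 hS) (Colombeau.Gc 𝕜 Ω) := by
  exact ⟨⟨Colombeau.GcIdeal 𝕜 Ω, rfl⟩, Colombeau.dense_Gc hS⟩
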